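/- Let $b\ge 2$ be an integer and $r\in\mathbb R$. For a sequence $x=x_0x_1x_2\dots$ over $\Sigma_b=\{0,\dots,b-1\}$, a word $w\in\Sigma_b^l$ with $l\ge 1$ and $n\ge l$, let $$P_n(x,w)=\frac{|\{i\in\{0,\dots,n-l\} : x_i\cdots x_{i+l-1}=w\}|}{n-l+1},\qquad H_{l,n}(x)=-\frac1l\sum_{w\in\Sigma_b^l}P_n(x,w)\log_b P_n(x,w)$$ (with $0\log_b 0=0$), and $$\dim_{FS}(x)=\inf_{l\ge1}\liminf_{n\to\infty}H_{l,n}(x),\qquad \mathrm{Dim}_{FS}(x)=\inf_{l\ge1}\limsup_{n\to\infty}H_{l,n}(x).$$ Let $\dim^b_{FS}(r)$ and $\mathrm{Dim}^b_{FS}(r)$ be these quantities for the sequence of base-$b$ digits of the fractional part of $r$, the $i$-th digit ($i\ge0$) of $t\in[0,1)$ being $\lfloor b^{i+1}t\rfloor \bmod b$. Let $\mathcal W^b_r$ be the set of Borel probability measures $\mu$ on $\mathbb T=\mathbb R/\mathbb Z$ for which there are $n_1<n_2<\cdots$ with $$\lim_{s\to\infty}\frac1{n_s}\sum_{j=0}^{n_s-1}e^{2\pi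 i k b^j r}=\int_{\mathbb T} e^{2\pi i k y}\,d\mu(y)\quad\text{for every }k\in\mathbb Z.$$ Then: 1. If $x$ is any sequence over $\Sigma_b$ with $\sum_{i\ge0}x_i b^{-i-1}\equiv r \pmod 1$, then $\dim_{FS}(x)=\dim^b_{FS}(r)$ and $\mathrm{Dim}_{FS}(x)=\mathrm{Dim}^b_{FS}(r)$. 2. For every positive integer $m$, $\dim^b_{FS}(mr)=\dim^b_{FS}(r)$ and $\mathrm{Dim}^b_{FS}(mr)=\mathrm{Dim}^b_{FS}(r)$. 3. For every nonzero rational $q$, $\dim^b_{FS}(q+r)=\dim^b_{FS}(qr)=\dim^b_{FS}(r)$ and $\mathrm{Dim}^b_{FS}(q+r)=\mathrm{Dim}^b_{FS}(qr)=\mathrm{Dim}^b_{FS}(r)$. 4. For every positive integer $m$, $\mathcal W^b_{mr}=\{(f_m)_*\mu : \mu\in\mathcal W^b_r\}$, where $f_m:\mathbb T\to\mathbb T$, $f_m(y)=my \bmod 1$, and $(f_m)_*$ denotes pushforward. -/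

import Mathlib

open Filter Topology MeasureTheory

noncomputable section

namespace FiniteState

/-- Sliding count probability of the block `w` in the prefix of length `n` of `x`: the proportion of
the `n - l + 1` positions `i ∈ [0, n - l]` at which `w` occurs (and `0` when `n < l`). -/
def slidingProb {b : ℕ} (x : ℕ → Fin b) (n : ℕ) {l : ℕ} (w : Fin l → Fin b) : ℝ :=
  ((Finset.range (n + 1 - l)).filter (fun i => ∀ j : Fin l, x (i + j) = w j)).card /
    ((n + 1 - l : ℕ) : ℝ)

/-- Sliding block entropy of block length `l` of the prefix of length `n` of `x`. The logarithm is
taken to the base `b`, the size of the alphabet, and `Real.logb b 0 = 0` gives `0 log 0 = 0`. -/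
def slidingEntropy {b : ℕ} (x : ℕ → Fin b) (l n : ℕ) : ℝ :=
  -(1 / (l : ℝ)) * ∑ w : Fin l → Fin b, slidingProb x n w * Real.logb b (slidingProb x n w)

/-- Finite-state dimension of a sequence over an alphabet with `b` letters. -/
def seqDim {b : ℕ} (x : ℕ → Fin b) : ℝ :=
  ⨅ l : ℕ+, liminf (fun n : ℕ => slidingEntropy x l n) atTop

/-- Finite-state strong dimension of a sequence over an alphabet with `b` letters. -/
def seqStrongDim {b : ℕ} (x : ℕ → Fin b) : ℝ :=
  ⨅ l : ℕ+, limsup (fun n : ℕ => slidingEntropy x l n) atTop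

/-- `x` is a base-`b` expansion of `r` modulo one: `∑ i, x i / b ^ (i + 1) ≡ r` modulo one. -/
def IsExpansion {b : ℕ} (x : ℕ → Fin b) (r : ℝ) : Prop :=
  ((Real.ofDigits x : ℝ) : UnitAddCircle) = (r : UnitAddCircle)

/-- Base-`b` finite-state dimension of a real number, computed on the base-`b` digits
of its fractional part. -/
def dim (b : ℕ) [NeZero b] (r : ℝ) : ℝ :=
  seqDim (Real.digits (Int.fract r) b)

/-- Base-`b` finite-state strong dimension of a real number, computed on the base-`b` digits
of its fractional part. -/
def strongDim (b : ℕ) [NeZero b] (r : ℝ) : ℝ :=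
  seqStrongDim (Real.digits (Int.fract r) b)

/-- The `k`-th Weyl average `(1 / n) ∑_{j < n} exp (2 π i k b ^ j r)`. -/
def weylAverage (b : ℕ) (r : ℝ) (k : ℤ) (n : ℕ) : ℂ :=
  (1 / (n : ℂ)) *
    ∑ j ∈ Finset.range n, Complex.exp (2 * Real.pi * Complex.I * k * (b : ℂ) ^ j * (r : ℂ))

/-- The limit measures of `r` in base `b`: the probability measures on the circle `ℝ / ℤ` whose
Fourier coefficients `∫ exp (2 π i k y) dμ(y)` are, simultaneously for all integers `k`, the limits
of the Weyl averages of `r` along one subsequence. -/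
def limitMeasures (b : ℕ) (r : ℝ) : Set (Measure UnitAddCircle) :=
  {μ | IsProbabilityMeasure μ ∧ ∃ n : ℕ → ℕ, StrictMono n ∧
    ∀ k : ℤ, Tendsto (fun s => weylAverage b r k (n s)) atTop (𝓝 (∫ y, fourier k y ∂μ))}

end FiniteState

end

/-! Suppose `y` expands `m * r + z` and `x` expands `r`, with `m ≠ 0` and `z` integers. Then every
tail of `y` is `m` times the corresponding tail of `x` plus an integer carry, and the carries are
bounded because tails lie in `[0, 1]`. So, at a given position, a block of `y` and the block of `x`
determine each other once the carries at its two ends are known, and their entropies differ by a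
constant `C` independent of the block length (`exists_abs_blockEntropy_sub_le`). Block entropy is
asymptotically subadditive (`eventually_blockEntropy_mul_le`), so passing from `l` to a large
multiple `k * l` divides this loss by `k * l` and the infimum over lengths does not see it
(`seqDim_le`, `seqStrongDim_le`). The case `m = 1` covers ambiguous expansions; clearing
denominators covers rationals.

For limit measures, multiplying `r` by `m` turns frequency `k` into `k * m`, as does pushforward
under `y ↦ m • y`. Weak compactness and uniqueness of Fourier coefficients finish the argument. -/

namespace FiniteState

/-! ### Empirical entropy: monotonicity, subadditivity, the uniform bound. -/

section Entropy

variable {ι A B : Type*} [DecidableEq A] [DecidableEq B]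

/-- The number of indices in `I` at which `f` takes the value `a`. -/
def fiberCount (I : Finset ι) (f : ι → A) (a : A) : ℝ :=
  ((I.filter fun i => f i = a).card : ℝ)

/-- The empirical entropy of `f` on `I`, in natural units and multiplied by the size of `I`. -/
noncomputable def totalEntropy (I : Finset ι) (f : ι → A) : ℝ :=
  ∑ i ∈ I, Real.log ((I.card : ℝ) / fiberCount I f (f i))

lemma fiberCount_nonneg (I : Finset ι) (f : ι → A) (a : A) : 0 ≤ fiberCount I f a :=
  Nat.cast_nonneg _

lemma fiberCount_le_card (I : Finset ι) (f : ι → A) (a : A) : fiberCount I f a ≤ I.card :=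
  Nat.cast_le.2 (Finset.card_filter_le _ _)

lemma fiberCount_pos {I : Finset ι} (f : ι → A) {i : ι} (hi : i ∈ I) :
    0 < fiberCount I f (f i) :=
  Nat.cast_pos.2 (Finset.card_pos.2 ⟨i, by simp [hi]⟩)

lemma card_cast_pos {I : Finset ι} {i : ι} (hi : i ∈ I) : (0 : ℝ) < I.card :=
  Nat.cast_pos.2 (Finset.card_pos.2 ⟨i, hi⟩)

lemma sum_comp_eq_sum_fiberCount [Fintype A] (I : Finset ι) (f : ι → A) (g : A → ℝ) :
    ∑ i ∈ I, g (f i) = ∑ a, fiberCount I f a * g a := by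
  rw [← Finset.sum_fiberwise I f]
  refine Finset.sum_congr rfl fun a _ => ?_
  rw [Finset.sum_congr rfl (g := fun _ => g a) fun i hi => by rw [(Finset.mem_filter.1 hi).2]]
  simp [fiberCount]

lemma sum_fiberCount [Fintype A] (I : Finset ι) (f : ι → A) :
    ∑ a, fiberCount I f a = I.card := by
  simpa using (sum_comp_eq_sum_fiberCount I f fun _ => 1).symm

lemma totalEntropy_nonneg (I : Finset ι) (f : ι → A) : 0 ≤ totalEntropy I f :=
  Finset.sum_nonneg fun _ hi => Real.log_nonneg <|
    (one_le_div (fiberCount_pos f hi)).2 (fiberCount_le_card _ _ _)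

lemma totalEntropy_mono {I : Finset ι} {f : ι → A} {g : ι → B}
    (h : ∀ i ∈ I, ∀ j ∈ I, f i = f j → g i = g j) : totalEntropy I g ≤ totalEntropy I f := by
  refine Finset.sum_le_sum fun i hi => Real.log_le_log ?_ ?_
  · exact div_pos (card_cast_pos hi) (fiberCount_pos g hi)
  · refine div_le_div_of_nonneg_left (Nat.cast_nonneg _) (fiberCount_pos f hi) ?_
    refine Nat.cast_le.2 (Finset.card_le_card fun j hj => ?_)
    rw [Finset.mem_filter] at hj ⊢
    exact ⟨hj.1, h j hj.1 i hi hj.2⟩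

/-- Gibbs' inequality: `log t ≤ t - 1`, with `t` the ratio of the product of the marginal
frequencies to the joint frequency, summed over positions. -/
lemma totalEntropy_prod_le [Fintype A] [Fintype B] (I : Finset ι) (f : ι → A) (g : ι → B) :
    totalEntropy I (fun i => (f i, g i)) ≤ totalEntropy I f + totalEntropy I g := by
  rcases I.eq_empty_or_nonempty with rfl | ⟨i₀, hi₀⟩
  · simp [totalEntropy]
  have hI : (0 : ℝ) < I.card := card_cast_pos hi₀
  set c := fiberCount I fun i => (f i, g i) with hc
  set G : A × B → ℝ := fun p =>
    fiberCount I f p.1 * fiberCount I g p.2 / (c p * I.card) with hG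
  have hterm : ∀ i ∈ I, Real.log (I.card / c (f i, g i)) ≤
      Real.log (I.card / fiberCount I f (f i)) + Real.log (I.card / fiberCount I g (g i)) +
        (G (f i, g i) - 1) := by
    intro i hi
    have h1 := fiberCount_pos f hi
    have h2 := fiberCount_pos g hi
    have h3 : 0 < c (f i, g i) := fiberCount_pos (fun i => (f i, g i)) hi
    have h4 : 0 < G (f i, g i) := by simp only [hG]; positivity
    have h5 := Real.log_le_sub_one_of_pos h4
    have h6 : Real.log (G (f i, g i)) = Real.log (fiberCount I f (f i)) +
        Real.log (fiberCount I g (g i)) - (Real.log (c (f i, g i)) + Real.log I.card) := by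
      simp only [hG]
      rw [Real.log_div (by positivity) (by positivity), Real.log_mul h1.ne' h2.ne',
        Real.log_mul h3.ne' hI.ne']
    rw [Real.log_div hI.ne' h1.ne', Real.log_div hI.ne' h2.ne', Real.log_div hI.ne' h3.ne']
    linarith
  have hsum : ∑ i ∈ I, (G (f i, g i) - 1) ≤ 0 := by
    rw [Finset.sum_sub_distrib, sum_comp_eq_sum_fiberCount I (fun i => (f i, g i)) G]
    have hle : ∑ p, fiberCount I (fun i => (f i, g i)) p * G p ≤
        ∑ p : A × B, fiberCount I f p.1 * fiberCount I g p.2 / I.card := by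
      refine Finset.sum_le_sum fun p _ => ?_
      -- Pairs that never occur contribute `0` on the left, hence an inequality only.
      rcases (fiberCount_nonneg I (fun i => (f i, g i)) p).eq_or_lt with h0 | h0
      · rw [← h0, zero_mul]
        exact div_nonneg (mul_nonneg (fiberCount_nonneg _ _ _) (fiberCount_nonneg _ _ _)) hI.le
      · simp only [hG, hc]
        exact le_of_eq (by field_simp)
    have heq : ∑ p : A × B, fiberCount I f p.1 * fiberCount I g p.2 / I.card = I.card := by
      rw [← Finset.sum_div, Fintype.sum_prod_type, ← Finset.sum_mul_sum, sum_fiberCount,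
        sum_fiberCount, mul_div_assoc, div_self hI.ne', mul_one]
    simp only [Finset.sum_const, nsmul_eq_mul, mul_one]
    linarith
  calc totalEntropy I (fun i => (f i, g i)) ≤ ∑ i ∈ I, _ := Finset.sum_le_sum hterm
    _ ≤ _ := by
      rw [Finset.sum_add_distrib, Finset.sum_add_distrib]
      simp only [totalEntropy]
      linarith

/-- Gibbs' inequality again, against the uniform distribution on `A`. -/
lemma totalEntropy_le_card_mul_log [Fintype A] (I : Finset ι) (f : ι → A) :
    totalEntropy I f ≤ I.card * Real.log (Fintype.card A) := by
  rcases I.eq_empty_or_nonempty with rfl | ⟨i₀, hi₀⟩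
  · simp [totalEntropy]
  have hI : (0 : ℝ) < I.card := card_cast_pos hi₀
  have hK : (0 : ℝ) < Fintype.card A := Nat.cast_pos.2 (Fintype.card_pos_iff.2 ⟨f i₀⟩)
  set G : A → ℝ := fun a => I.card / (fiberCount I f a * Fintype.card A) with hG
  have hterm : ∀ i ∈ I, Real.log (I.card / fiberCount I f (f i)) ≤
      Real.log (Fintype.card A) + (G (f i) - 1) := by
    intro i hi
    have h1 := fiberCount_pos f hi
    have h4 : 0 < G (f i) := by simp only [hG]; positivity
    have h5 := Real.log_le_sub_one_of_pos h4
    have h6 : Real.log (G (f i)) = Real.log I.card - (Real.log (fiberCount I f (f i)) +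
        Real.log (Fintype.card A)) := by
      simp only [hG]
      rw [Real.log_div hI.ne' (by positivity), Real.log_mul h1.ne' hK.ne']
    rw [Real.log_div hI.ne' h1.ne']
    linarith
  have hsum : ∑ i ∈ I, (G (f i) - 1) ≤ 0 := by
    rw [Finset.sum_sub_distrib, sum_comp_eq_sum_fiberCount I f G]
    have hle : ∑ a, fiberCount I f a * G a ≤ ∑ _a : A, (I.card : ℝ) / Fintype.card A := by
      refine Finset.sum_le_sum fun a _ => ?_
      rcases (fiberCount_nonneg I f a).eq_or_lt with h0 | h0
      · rw [← h0, zero_mul]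
        positivity
      · simp only [hG]
        exact le_of_eq (by field_simp)
    have heq : ∑ _a : A, (I.card : ℝ) / Fintype.card A = I.card := by
      rw [Finset.sum_const, Finset.card_univ, nsmul_eq_mul]
      field_simp
    simp only [Finset.sum_const, nsmul_eq_mul, mul_one] at hle heq ⊢
    linarith
  calc totalEntropy I f ≤ ∑ i ∈ I, _ := Finset.sum_le_sum hterm
    _ ≤ _ := by
      rw [Finset.sum_add_distrib, Finset.sum_const, nsmul_eq_mul]
      linarith

lemma totalEntropy_div_card [Fintype A] (I : Finset ι) (f : ι → A) :
    totalEntropy I f / I.card = ∑ a, Real.negMulLog (fiberCount I f a / I.card) := by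
  rw [totalEntropy, sum_comp_eq_sum_fiberCount I f fun a => Real.log (I.card / fiberCount I f a),
    Finset.sum_div]
  refine Finset.sum_congr rfl fun a _ => ?_
  have hlog : Real.log (fiberCount I f a / I.card) = -Real.log (I.card / fiberCount I f a) := by
    rw [← Real.log_inv, inv_div]
  rw [Real.negMulLog, hlog]
  ring

end Entropy

/-! ### Block entropy and its asymptotic subadditivity in the block length. -/

section Blocks

variable {b : ℕ}

/-- The block of length `l` of `x` starting at position `i`. -/
def block (x : ℕ → Fin b) (l i : ℕ) : Fin l → Fin b := fun j => x (i + j)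

/-- Total entropy of the blocks of length `l` of `x` starting at the first `n` positions. -/
noncomputable def blockEntropy (x : ℕ → Fin b) (l n : ℕ) : ℝ :=
  totalEntropy (Finset.range n) (block x l)

lemma block_eq_iff {x : ℕ → Fin b} {l i j : ℕ} :
    block x l i = block x l j ↔ ∀ t < l, x (i + t) = x (j + t) := by
  simp only [block, funext_iff, Fin.forall_iff]

/-- A prefix of length `n + (l - 1)` has exactly `n` windows of length `l`. -/
lemma slidingEntropy_add (x : ℕ → Fin b) {l : ℕ} (hl : 0 < l) (n : ℕ) :
    slidingEntropy x l (n + (l - 1)) = blockEntropy x l n / n / (l * Real.log b) := by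
  have h := totalEntropy_div_card (Finset.range n) (block x l)
  rw [Finset.card_range] at h
  have hn : n + (l - 1) + 1 - l = n := by omega
  rw [blockEntropy, h, slidingEntropy, Finset.mul_sum, Finset.sum_div]
  refine Finset.sum_congr rfl fun w _ => ?_
  have hp : slidingProb x (n + (l - 1)) w = fiberCount (Finset.range n) (block x l) w / n := by
    simp only [slidingProb, hn, fiberCount, block, funext_iff]
  rw [hp, Real.negMulLog, Real.logb]
  simp only [div_eq_mul_inv, mul_inv]
  ring

lemma blockEntropy_mul_le (x : ℕ → Fin b) (l n k : ℕ) :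
    blockEntropy x (k * l) n ≤
      ∑ j ∈ Finset.range k, totalEntropy (Finset.range n) (fun i => block x l (i + j * l)) := by
  induction k with
  | zero =>
    refine (totalEntropy_le_card_mul_log _ _).trans ?_
    simp
  | succ k ih =>
    rw [Finset.sum_range_succ]
    refine le_trans ?_ (add_le_add_left ih _)
    refine le_trans (totalEntropy_mono ?_) (totalEntropy_prod_le _ _ _)
    intro i _ j _ hij
    rw [Prod.mk.injEq, block_eq_iff, block_eq_iff] at hij
    rw [block_eq_iff]
    intro t ht
    rcases lt_or_ge t (k * l) with h | h
    · exact hij.1 t h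
    · have := hij.2 (t - k * l) (by rw [Nat.add_mul, one_mul] at ht; omega)
      rwa [add_assoc, add_assoc, Nat.add_sub_cancel' h] at this

/-- The two ranges of positions differ by `s` initial and `s` final terms, which `key` exchanges. -/
lemma abs_fiberCount_shift_le {A : Type*} [DecidableEq A] (f : ℕ → A) (s n : ℕ) (a : A) :
    |fiberCount (Finset.range n) (fun i => f (i + s)) a - fiberCount (Finset.range n) f a| ≤ s := by
  have key : ∀ n, (Finset.range n).sum (fun i => if f (i + s) = a then (1 : ℝ) else 0) +
      (Finset.range s).sum (fun i => if f i = a then (1 : ℝ) else 0) =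
      (Finset.range n).sum (fun i => if f i = a then (1 : ℝ) else 0) +
      (Finset.range s).sum (fun i => if f (n + i) = a then (1 : ℝ) else 0) := by
    intro n
    rw [← Finset.sum_range_add, add_comm n s, Finset.sum_range_add, add_comm]
    simp only [add_comm s]
  have hb : ∀ g : ℕ → ℕ, 0 ≤ (Finset.range s).sum (fun i => if f (g i) = a then (1 : ℝ) else 0) ∧
      (Finset.range s).sum (fun i => if f (g i) = a then (1 : ℝ) else 0) ≤ s := by
    intro g
    refine ⟨Finset.sum_nonneg fun i _ => by split_ifs <;> norm_num, ?_⟩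
    refine (Finset.sum_le_card_nsmul _ _ 1 fun i _ => by split_ifs <;> norm_num).trans ?_
    simp
  have h1 := hb id
  have h2 := hb fun i => n + i
  have h3 := key n
  simp only [id] at h1
  simp only [fiberCount, Finset.card_filter, Nat.cast_sum, Nat.cast_ite, Nat.cast_one,
    Nat.cast_zero]
  rw [abs_le]
  constructor <;> linarith [h1.1, h1.2, h2.1, h2.2]

/-- Frequencies move by at most `s / n`, and `Real.negMulLog` is uniformly continuous on `[0, 1]`.
-/
lemma tendsto_totalEntropy_shift {A : Type*} [DecidableEq A] [Fintype A] (f : ℕ → A) (s : ℕ) :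
    Tendsto (fun n : ℕ => totalEntropy (Finset.range n) (fun i => f (i + s)) / n -
      totalEntropy (Finset.range n) f / n) atTop (𝓝 0) := by
  have hrw : ∀ (g : ℕ → A) (n : ℕ), totalEntropy (Finset.range n) g / n =
      ∑ a, Real.negMulLog (fiberCount (Finset.range n) g a / n) := by
    intro g n
    simpa using totalEntropy_div_card (Finset.range n) g
  simp only [hrw, ← Finset.sum_sub_distrib]
  rw [← Finset.sum_const_zero (s := (Finset.univ : Finset A))]
  refine tendsto_finsetSum _ fun a _ => ?_
  have huc : UniformContinuousOn Real.negMulLog (Set.Icc 0 1) :=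
    isCompact_Icc.uniformContinuousOn_of_continuous Real.continuous_negMulLog.continuousOn
  have hmem : ∀ (g : ℕ → A) (n : ℕ), fiberCount (Finset.range n) g a / n ∈ Set.Icc (0 : ℝ) 1 := by
    intro g n
    refine ⟨div_nonneg (fiberCount_nonneg _ _ _) (Nat.cast_nonneg _),
      div_le_one_of_le₀ ?_ (Nat.cast_nonneg _)⟩
    simpa using fiberCount_le_card (Finset.range n) g a
  rw [Metric.tendsto_atTop]
  intro ε hε
  obtain ⟨δ, hδ, h⟩ := Metric.uniformContinuousOn_iff.1 huc ε hε
  have hlim : Tendsto (fun n : ℕ => (s : ℝ) / n) atTop (𝓝 0) :=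
    tendsto_const_div_atTop_nhds_zero_nat _
  obtain ⟨N, hN⟩ := eventually_atTop.1 (hlim.eventually_lt_const hδ)
  refine ⟨N, fun n hn => ?_⟩
  rw [Real.dist_eq, sub_zero, ← Real.dist_eq]
  refine h _ (hmem _ n) _ (hmem _ n) ?_
  rw [Real.dist_eq, ← sub_div, abs_div, Nat.abs_cast]
  exact lt_of_le_of_lt (div_le_div_of_nonneg_right (abs_fiberCount_shift_le f s n a)
    (Nat.cast_nonneg _)) (hN n hn)

lemma eventually_blockEntropy_mul_le (x : ℕ → Fin b) (l k : ℕ) {ε : ℝ} (hε : 0 < ε) :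
    ∀ᶠ n : ℕ in atTop, blockEntropy x (k * l) n / n ≤ k * (blockEntropy x l n / n) + ε := by
  have h : Tendsto (fun n : ℕ => ∑ j ∈ Finset.range k,
      (totalEntropy (Finset.range n) (fun i => block x l (i + j * l)) / n -
        totalEntropy (Finset.range n) (block x l) / n)) atTop (𝓝 (∑ _j ∈ Finset.range k, 0)) :=
    tendsto_finsetSum _ fun j _ => tendsto_totalEntropy_shift (block x l) (j * l)
  rw [Finset.sum_const_zero] at h
  filter_upwards [h.eventually_lt_const hε] with n hn
  rw [Finset.sum_sub_distrib, ← Finset.sum_div, Finset.sum_const, Finset.card_range,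
    nsmul_eq_mul] at hn
  have := div_le_div_of_nonneg_right (blockEntropy_mul_le x l n k) (Nat.cast_nonneg (α := ℝ) n)
  simp only [blockEntropy] at this ⊢
  linarith

end Blocks

/-! ### Carries between expansions of `r` and `m * r + z`. -/

section Expansions

variable {b : ℕ}

/-- The real number with base-`b` digits `x i, x (i + 1), …`. -/
noncomputable def tailValue (x : ℕ → Fin b) (i : ℕ) : ℝ := Real.ofDigits fun j => x (j + i)

/-- The integer with base-`b` digits `x i, …, x (i + l - 1)`, most significant first. -/
def blockValue (x : ℕ → Fin b) (i : ℕ) : ℕ → ℤ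
  | 0 => 0
  | l + 1 => b * blockValue x i l + (x (i + l) : ℕ)

lemma mul_tailValue (x : ℕ → Fin b) (i : ℕ) :
    b * tailValue x i = (x i : ℕ) + tailValue x (i + 1) := by
  have hb : (b : ℝ) ≠ 0 := Nat.cast_ne_zero.2 (Fin.pos (x 0)).ne'
  have h := Real.ofDigits_eq_sum_add_ofDigits (fun j => x (j + i)) 1
  simp only [Finset.sum_range_one, Real.ofDigitsTerm, zero_add, pow_one] at h
  have h2 : (fun j => x (j + 1 + i)) = fun j => x (j + (i + 1)) := by
    funext j
    rw [add_assoc, add_comm 1 i]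
  rw [h2] at h
  rw [tailValue, h, tailValue]
  field_simp

lemma pow_mul_tailValue (x : ℕ → Fin b) (i l : ℕ) :
    (b : ℝ) ^ l * tailValue x i = blockValue x i l + tailValue x (i + l) := by
  induction l with
  | zero => simp [blockValue]
  | succ l ih =>
    rw [pow_succ', mul_assoc, ih, mul_add, mul_tailValue, blockValue]
    push_cast
    ring_nf

/-- Reduction modulo `b` isolates the last digit; cancelling it leaves a shorter block. -/
lemma blockValue_injective {x : ℕ → Fin b} {i j l : ℕ}
    (h : blockValue x i l = blockValue x j l) : block x l i = block x l j := by
  rw [block_eq_iff]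
  induction l with
  | zero => simp
  | succ l ih =>
    simp only [blockValue] at h
    have hi : ((x (i + l) : ℕ) : ℤ) < b := Nat.cast_lt.2 (x (i + l)).2
    have hj : ((x (j + l) : ℕ) : ℤ) < b := Nat.cast_lt.2 (x (j + l)).2
    have hd : ((x (i + l) : ℕ) : ℤ) = (x (j + l) : ℕ) := by
      have := congrArg (· % (b : ℤ)) h
      simpa [Int.add_emod, Int.emod_eq_of_lt, hi, hj] using this
    have hb : (b : ℤ) ≠ 0 := by
      have := Fin.pos (x 0)
      omega
    have hv : blockValue x i l = blockValue x j l := by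
      rw [hd] at h
      exact mul_left_cancel₀ hb (add_right_cancel h)
    intro t ht
    rcases Nat.lt_succ_iff_lt_or_eq.1 ht with h1 | rfl
    · exact ih hv t h1
    · exact Fin.ext (by exact_mod_cast hd)

lemma blockValue_congr {x : ℕ → Fin b} {i j l : ℕ}
    (h : block x l i = block x l j) : blockValue x i l = blockValue x j l := by
  rw [block_eq_iff] at h
  induction l with
  | zero => rfl
  | succ l ih =>
    rw [blockValue, blockValue, ih fun t ht => h t (by omega), h l (by omega)]

lemma exists_carry {x y : ℕ → Fin b} {m z : ℤ} (h : tailValue y 0 = m * tailValue x 0 + z) :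
    ∃ c : ℕ → ℤ, ∀ i, tailValue y i = m * tailValue x i + c i := by
  suffices ∀ i, ∃ c : ℤ, tailValue y i = m * tailValue x i + c from Classical.skolem.1 this
  intro i
  induction i with
  | zero => exact ⟨z, h⟩
  | succ i ih =>
    obtain ⟨c, hc⟩ := ih
    -- The recurrence for carries, from multiplying the relation at `i` by `b` and removing the
    -- leading digits.
    refine ⟨m * (x i : ℕ) + b * c - (y i : ℕ), ?_⟩
    have h1 := mul_tailValue x i
    have h2 := mul_tailValue y i
    rw [hc] at h2
    push_cast
    linear_combination m * h1 - h2

lemma abs_tailValue_le_one (x : ℕ → Fin b) (i : ℕ) : |tailValue x i| ≤ 1 :=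
  abs_le.2 ⟨by linarith [show 0 ≤ tailValue x i from Real.ofDigits_nonneg _],
    Real.ofDigits_le_one _⟩

lemma abs_carry_le {x y : ℕ → Fin b} {m c : ℤ} {i : ℕ}
    (h : tailValue y i = m * tailValue x i + c) : |c| ≤ |m| + 1 := by
  have h1 := abs_tailValue_le_one y i
  have h2 := abs_tailValue_le_one x i
  have h3 : (c : ℝ) = tailValue y i - m * tailValue x i := by linarith
  have h4 : |(c : ℝ)| ≤ |(m : ℝ)| + 1 := by
    rw [h3]
    refine (abs_sub _ _).trans ?_
    rw [abs_mul]
    nlinarith [abs_nonneg (m : ℝ)]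
  exact_mod_cast h4

lemma exists_abs_blockEntropy_sub_le {x y : ℕ → Fin b} {m z : ℤ} (hm : m ≠ 0)
    (h : tailValue y 0 = m * tailValue x 0 + z) :
    ∃ C : ℝ, ∀ l n : ℕ, blockEntropy y l n ≤ blockEntropy x l n + n * C ∧
      blockEntropy x l n ≤ blockEntropy y l n + n * C := by
  obtain ⟨c, hc⟩ := exists_carry h
  let S := Finset.Icc (-(|m| + 1)) (|m| + 1)
  let d : ℕ → S := fun i => ⟨c i, Finset.mem_Icc.2 (abs_le.1 (abs_carry_le (hc i)))⟩
  have hd : ∀ i j, d i = d j → c i = c j := fun i j hij => congrArg Subtype.val hij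
  -- The tail relation at `i`, scaled by `b ^ l`, minus the one at `i + l`: an identity between
  -- integers in which only the carries at the two ends remain.
  have hkey : ∀ i l, blockValue y i l + c (i + l) = m * blockValue x i l + b ^ l * c i := by
    intro i l
    have h1 := pow_mul_tailValue x i l
    have h2 := pow_mul_tailValue y i l
    rw [hc, hc] at h2
    have : ((blockValue y i l + c (i + l) : ℤ) : ℝ) =
        ((m * blockValue x i l + b ^ l * c i : ℤ) : ℝ) := by
      push_cast
      linear_combination m * h1 - h2
    exact_mod_cast this
  refine ⟨Real.log (Fintype.card (S × S)), fun l n => ?_⟩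
  have hbound : totalEntropy (Finset.range n) (fun i => (d i, d (i + l))) ≤
      n * Real.log (Fintype.card (S × S)) := by
    simpa only [Finset.card_range] using
      totalEntropy_le_card_mul_log (Finset.range n) fun i => (d i, d (i + l))
  constructor
  · refine le_trans (totalEntropy_mono (f := fun i => (block x l i, (d i, d (i + l)))) ?_)
      ((totalEntropy_prod_le _ _ _).trans (add_le_add_right hbound _))
    intro i _ j _ hij
    simp only [Prod.mk.injEq] at hij
    apply blockValue_injective
    have h1 := hkey i l
    have h2 := hkey j l
    rw [blockValue_congr hij.1, hd _ _ hij.2.1, hd _ _ hij.2.2] at h1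
    linarith
  · refine le_trans (totalEntropy_mono (f := fun i => (block y l i, (d i, d (i + l)))) ?_)
      ((totalEntropy_prod_le _ _ _).trans (add_le_add_right hbound _))
    intro i _ j _ hij
    simp only [Prod.mk.injEq] at hij
    apply blockValue_injective
    have h1 := hkey i l
    have h2 := hkey j l
    rw [blockValue_congr hij.1, hd _ _ hij.2.1, hd _ _ hij.2.2] at h1
    -- Recovering the `x`-block means dividing by `m`, so `m ≠ 0` is needed here.
    exact mul_left_cancel₀ hm (by linarith)

end Expansions

/-! ### Invariance of the finite-state dimensions. -/

section Dimension

variable {b : ℕ}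

/-- Entropy per symbol of the blocks of length `l` of `x` starting at the first `n` positions. -/
noncomputable def blockRate (x : ℕ → Fin b) (l n : ℕ) : ℝ :=
  blockEntropy x l n / n / (l * Real.log b)

lemma log_base_nonneg (b : ℕ) : 0 ≤ Real.log b := Real.log_natCast_nonneg b

lemma blockRate_nonneg (x : ℕ → Fin b) (l n : ℕ) : 0 ≤ blockRate x l n :=
  div_nonneg (div_nonneg (totalEntropy_nonneg _ _) (Nat.cast_nonneg _))
    (mul_nonneg (Nat.cast_nonneg _) (log_base_nonneg b))

lemma blockRate_le (x : ℕ → Fin b) (l n : ℕ) :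
    blockRate x l n ≤ Real.log (Fintype.card (Fin l → Fin b)) / (l * Real.log b) := by
  refine div_le_div_of_nonneg_right ?_ (mul_nonneg (Nat.cast_nonneg _) (log_base_nonneg b))
  refine div_le_of_le_mul₀ (Nat.cast_nonneg _) (Real.log_natCast_nonneg _) ?_
  rw [mul_comm]
  have h := totalEntropy_le_card_mul_log (Finset.range n) (block x l)
  rwa [Finset.card_range] at h

lemma isBoundedUnder_ge_blockRate (x : ℕ → Fin b) (l : ℕ) :
    IsBoundedUnder (· ≥ ·) atTop (blockRate x l) :=
  isBoundedUnder_of ⟨0, blockRate_nonneg x l⟩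

lemma isBoundedUnder_le_blockRate (x : ℕ → Fin b) (l : ℕ) :
    IsBoundedUnder (· ≤ ·) atTop (blockRate x l) :=
  isBoundedUnder_of ⟨_, blockRate_le x l⟩

lemma liminf_slidingEntropy (x : ℕ → Fin b) {l : ℕ} (hl : 0 < l) :
    liminf (fun n => slidingEntropy x l n) atTop = liminf (blockRate x l) atTop := by
  rw [← liminf_nat_add _ (l - 1)]
  simp only [slidingEntropy_add x hl]
  rfl

lemma limsup_slidingEntropy (x : ℕ → Fin b) {l : ℕ} (hl : 0 < l) :
    limsup (fun n => slidingEntropy x l n) atTop = limsup (blockRate x l) atTop := by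
  rw [← limsup_nat_add _ (l - 1)]
  simp only [slidingEntropy_add x hl]
  rfl

lemma exists_eventually_blockRate_le (hb : 1 < b) {x y : ℕ → Fin b} {C : ℝ}
    (h : ∀ l n, blockEntropy y l n ≤ blockEntropy x l n + n * C) {l : ℕ} (hl : 0 < l)
    {ε : ℝ} (hε : 0 < ε) :
    ∃ k : ℕ, 0 < k ∧ ∀ᶠ n : ℕ in atTop, blockRate y (k * l) n ≤ blockRate x l n + ε := by
  have hlog : 0 < Real.log b := Real.log_pos (Nat.one_lt_cast.2 hb)
  have hl' : (0 : ℝ) < l := Nat.cast_pos.2 hl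
  -- The total loss is `C` from the carries plus the error `1` allowed in subadditivity; normalising
  -- by `(k + 1) * l * Real.log b` brings it below `ε`.
  obtain ⟨k, hk⟩ := exists_nat_gt ((1 + C) / (l * Real.log b) / ε)
  refine ⟨k + 1, k.succ_pos, ?_⟩
  have hk' : (1 + C) ≤ ε * ((k + 1 : ℝ) * l * Real.log b) := by
    rw [div_lt_iff₀ hε, div_lt_iff₀ (by positivity)] at hk
    have : 0 < ε * (l * Real.log b) := by positivity
    linarith
  filter_upwards [eventually_blockEntropy_mul_le x l (k + 1) one_pos, eventually_gt_atTop 0]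
    with n hn hn0
  have hn' : (0 : ℝ) < n := Nat.cast_pos.2 hn0
  have h1 : blockEntropy y ((k + 1) * l) n / n ≤ blockEntropy x ((k + 1) * l) n / n + C := by
    rw [div_add' _ _ _ hn'.ne', mul_comm C]
    exact div_le_div_of_nonneg_right (h _ _) hn'.le
  rw [Nat.cast_succ] at hn
  rw [blockRate, blockRate, Nat.cast_mul, Nat.cast_succ, div_le_iff₀ (by positivity),
    add_mul (_ / _)]
  have h2 : blockEntropy x l n / n / (l * Real.log b) * ((k + 1) * l * Real.log b) =
      (k + 1) * (blockEntropy x l n / n) := by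
    field_simp
  linarith

lemma isBoundedUnder_le_add_const {g : ℕ → ℝ} (hg : IsBoundedUnder (· ≤ ·) atTop g) (ε : ℝ) :
    IsBoundedUnder (· ≤ ·) atTop fun n => g n + ε := by
  obtain ⟨c, hc⟩ := hg
  exact ⟨c + ε, eventually_map.2 ((eventually_map.1 hc).mono fun _ h => add_le_add_left h ε)⟩

lemma liminf_le_of_eventually_le_add {f g : ℕ → ℝ} {ε : ℝ}
    (hf : IsBoundedUnder (· ≥ ·) atTop f) (hg : IsBoundedUnder (· ≥ ·) atTop g)
    (hg' : IsBoundedUnder (· ≤ ·) atTop g) (h : ∀ᶠ n in atTop, f n ≤ g n + ε) :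
    liminf f atTop ≤ liminf g atTop + ε := by
  rw [← liminf_add_const atTop g ε hg'.isCoboundedUnder_ge hg]
  refine liminf_le_liminf h hf ?_
  exact (isBoundedUnder_le_add_const hg' ε).isCoboundedUnder_ge

lemma limsup_le_of_eventually_le_add {f g : ℕ → ℝ} {ε : ℝ}
    (hf : IsBoundedUnder (· ≥ ·) atTop f) (hg : IsBoundedUnder (· ≥ ·) atTop g)
    (hg' : IsBoundedUnder (· ≤ ·) atTop g) (h : ∀ᶠ n in atTop, f n ≤ g n + ε) :
    limsup f atTop ≤ limsup g atTop + ε := by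
  rw [← limsup_add_const atTop g ε hg' hg.isCoboundedUnder_le]
  refine limsup_le_limsup h hf.isCoboundedUnder_le ?_
  exact isBoundedUnder_le_add_const hg' ε

lemma seqDim_le (hb : 1 < b) {x y : ℕ → Fin b} {C : ℝ}
    (h : ∀ l n, blockEntropy y l n ≤ blockEntropy x l n + n * C) : seqDim y ≤ seqDim x := by
  refine le_ciInf fun l => le_of_forall_pos_le_add fun ε hε => ?_
  obtain ⟨k, hk, hev⟩ := exists_eventually_blockRate_le hb h l.pos hε
  have hbdd : BddBelow (Set.range fun l : ℕ+ => liminf (fun n => slidingEntropy y l n) atTop) := by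
    refine ⟨0, ?_⟩
    rintro _ ⟨l, rfl⟩
    simp only [liminf_slidingEntropy y l.pos]
    exact le_liminf_of_le (isBoundedUnder_le_blockRate y l).isCoboundedUnder_ge
      (Eventually.of_forall (blockRate_nonneg y l))
  refine (ciInf_le hbdd (⟨k, hk⟩ * l)).trans ?_
  rw [liminf_slidingEntropy x l.pos, liminf_slidingEntropy y (⟨k, hk⟩ * l : ℕ+).pos]
  exact liminf_le_of_eventually_le_add (isBoundedUnder_ge_blockRate y _)
    (isBoundedUnder_ge_blockRate x l) (isBoundedUnder_le_blockRate x l) hev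

lemma seqStrongDim_le (hb : 1 < b) {x y : ℕ → Fin b} {C : ℝ}
    (h : ∀ l n, blockEntropy y l n ≤ blockEntropy x l n + n * C) :
    seqStrongDim y ≤ seqStrongDim x := by
  refine le_ciInf fun l => le_of_forall_pos_le_add fun ε hε => ?_
  obtain ⟨k, hk, hev⟩ := exists_eventually_blockRate_le hb h l.pos hε
  have hbdd : BddBelow (Set.range fun l : ℕ+ => limsup (fun n => slidingEntropy y l n) atTop) := by
    refine ⟨0, ?_⟩
    rintro _ ⟨l, rfl⟩
    simp only [limsup_slidingEntropy y l.pos]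
    exact le_limsup_of_frequently_le (Frequently.of_forall (blockRate_nonneg y l))
      (isBoundedUnder_le_blockRate y l)
  refine (ciInf_le hbdd (⟨k, hk⟩ * l)).trans ?_
  rw [limsup_slidingEntropy x l.pos, limsup_slidingEntropy y (⟨k, hk⟩ * l : ℕ+).pos]
  exact limsup_le_of_eventually_le_add (isBoundedUnder_ge_blockRate y _)
    (isBoundedUnder_ge_blockRate x l) (isBoundedUnder_le_blockRate x l) hev

lemma IsExpansion.exists_int {x : ℕ → Fin b} {r : ℝ} (h : IsExpansion x r) :
    ∃ z : ℤ, tailValue x 0 = r + z := by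
  rw [IsExpansion, ← sub_eq_zero, ← AddCircle.coe_sub, AddCircle.coe_eq_zero_iff] at h
  obtain ⟨z, hz⟩ := h
  refine ⟨z, ?_⟩
  rw [zsmul_eq_mul, mul_one] at hz
  rw [hz, add_sub_cancel]
  rfl

lemma isExpansion_digits [NeZero b] (hb : 1 < b) (r : ℝ) :
    IsExpansion (Real.digits (Int.fract r) b) r := by
  rw [IsExpansion, Real.ofDigits_digits hb ⟨Int.fract_nonneg r, Int.fract_lt_one r⟩, AddCircle.coe_fract]

/-- Expansions of two reals that are proportional modulo one by a nonzero integer have the same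
finite-state dimensions. -/
lemma dims_eq_of_isExpansion (hb : 1 < b) {x y : ℕ → Fin b} {r : ℝ} {m z : ℤ} (hm : m ≠ 0)
    (hx : IsExpansion x r) (hy : IsExpansion y (m * r + z)) :
    seqDim y = seqDim x ∧ seqStrongDim y = seqStrongDim x := by
  obtain ⟨u, hu⟩ := hx.exists_int
  obtain ⟨v, hv⟩ := hy.exists_int
  obtain ⟨C, hC⟩ := exists_abs_blockEntropy_sub_le (x := x) (y := y) (m := m)
    (z := z + v - m * u) hm (by rw [hu, hv]; push_cast; ring)
  exact ⟨le_antisymm (seqDim_le hb fun l n => (hC l n).1) (seqDim_le hb fun l n => (hC l n).2),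
    le_antisymm (seqStrongDim_le hb fun l n => (hC l n).1)
      (seqStrongDim_le hb fun l n => (hC l n).2)⟩

lemma dim_int_mul_add [NeZero b] (hb : 1 < b) (r : ℝ) {m : ℤ} (hm : m ≠ 0) (z : ℤ) :
    dim b (m * r + z) = dim b r ∧ strongDim b (m * r + z) = strongDim b r :=
  dims_eq_of_isExpansion hb hm (isExpansion_digits hb r) (isExpansion_digits hb _)

/-- Both `q * r` and `r` have a common nonzero integer multiple, `q.num * r`. -/
lemma dim_rat_mul [NeZero b] (hb : 1 < b) (r : ℝ) {q : ℚ} (hq : q ≠ 0) :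
    dim b (q * r) = dim b r ∧ strongDim b (q * r) = strongDim b r := by
  have hd : (q.den : ℤ) ≠ 0 := Nat.cast_ne_zero.2 q.den_ne_zero
  have h1 := dim_int_mul_add hb ((q : ℝ) * r) hd 0
  have h2 := dim_int_mul_add hb r (Rat.num_ne_zero.2 hq) 0
  have heq : ((q.den : ℤ) : ℝ) * ((q : ℝ) * r) = (q.num : ℝ) * r := by
    rw [← mul_assoc]
    congr 1
    exact_mod_cast Rat.den_mul_eq_num q
  rw [heq] at h1
  exact ⟨h1.1.symm.trans h2.1, h1.2.symm.trans h2.2⟩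

lemma dim_rat_add [NeZero b] (hb : 1 < b) (r : ℝ) (q : ℚ) :
    dim b (q + r) = dim b r ∧ strongDim b (q + r) = strongDim b r := by
  have hd : (q.den : ℤ) ≠ 0 := Nat.cast_ne_zero.2 q.den_ne_zero
  have h1 := dim_int_mul_add hb ((q : ℝ) + r) hd 0
  have h2 := dim_int_mul_add hb r hd q.num
  have heq : ((q.den : ℤ) : ℝ) * ((q : ℝ) + r) + (0 : ℤ) = (q.den : ℤ) * r + (q.num : ℝ) := by
    have : ((q.den : ℤ) : ℝ) * (q : ℝ) = q.num := by exact_mod_cast Rat.den_mul_eq_num q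
    rw [mul_add, this]
    push_cast
    ring
  rw [heq] at h1
  exact ⟨h1.1.symm.trans h2.1, h1.2.symm.trans h2.2⟩

end Dimension

/-! ### Limit measures of the orbit and their pushforwards. -/

section LimitMeasures

/-- Integration is continuous in the sup norm, and the Fourier monomials span a dense subspace. -/
lemma ext_of_integral_fourier_eq {μ ν : Measure UnitAddCircle} [IsProbabilityMeasure μ]
    [IsProbabilityMeasure ν] (h : ∀ k : ℤ, ∫ y, fourier k y ∂μ = ∫ y, fourier k y ∂ν) :
    μ = ν := by
  have hint : ∀ (ρ : Measure UnitAddCircle) [IsProbabilityMeasure ρ] (f : C(UnitAddCircle, ℂ)),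
      Integrable f ρ := fun ρ _ f =>
    f.continuous.integrable_of_hasCompactSupport (HasCompactSupport.of_compactSpace f)
  have hcont : ∀ (ρ : Measure UnitAddCircle) [IsProbabilityMeasure ρ],
      Continuous fun f : C(UnitAddCircle, ℂ) => ∫ y, f y ∂ρ := by
    refine fun ρ _ => (LipschitzWith.of_dist_le_mul (K := 1) fun f g => ?_).continuous
    rw [dist_eq_norm, ← integral_sub (hint ρ f) (hint ρ g), NNReal.coe_one, one_mul]
    refine (norm_integral_le_of_norm_le_const (C := dist f g) (Eventually.of_forall fun y => ?_)).trans
      (by simp)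
    rw [← dist_eq_norm]
    exact ContinuousMap.dist_apply_le_dist y
  let S : Submodule ℂ C(UnitAddCircle, ℂ) :=
    { carrier := {f | ∫ y, f y ∂μ = ∫ y, f y ∂ν}
      zero_mem' := by simp
      add_mem' := fun {f g} hf hg => by
        simp only [Set.mem_ofPred_eq, ContinuousMap.add_apply] at hf hg ⊢
        rw [integral_add (hint μ f) (hint μ g), integral_add (hint ν f) (hint ν g), hf, hg]
      smul_mem' := fun c f hf => by
        simp only [Set.mem_ofPred_eq, ContinuousMap.smul_apply] at hf ⊢
        rw [integral_smul, integral_smul, hf] }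
  have hclosed : IsClosed (S : Set C(UnitAddCircle, ℂ)) := isClosed_eq (hcont μ) (hcont ν)
  have htop : (⊤ : Submodule ℂ C(UnitAddCircle, ℂ)) ≤ S := by
    rw [← span_fourier_closure_eq_top]
    refine Submodule.topologicalClosure_minimal _ (Submodule.span_le.2 ?_) hclosed
    rintro _ ⟨k, rfl⟩
    exact h k
  refine ext_of_forall_integral_eq_of_IsFiniteMeasure fun f => ?_
  have hf : ∫ y, ((f y : ℝ) : ℂ) ∂μ = ∫ y, ((f y : ℝ) : ℂ) ∂ν :=
    htop (x := ⟨fun y => (f y : ℂ), by fun_prop⟩) trivial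
  exact Complex.ofReal_injective
    ((integral_ofReal (𝕜 := ℂ)).symm.trans (hf.trans (integral_ofReal (𝕜 := ℂ))))

/-- The uniform probability measure on the first `n + 1` points of the orbit of `r` under
multiplication by `b` on the circle. -/
noncomputable def orbitMeasure (b : ℕ) (r : ℝ) (n : ℕ) : Measure UnitAddCircle :=
  (n + 1 : ENNReal)⁻¹ • ∑ j ∈ Finset.range (n + 1),
    Measure.dirac (((b : ℝ) ^ j * r : ℝ) : UnitAddCircle)

instance (b : ℕ) (r : ℝ) (n : ℕ) : IsProbabilityMeasure (orbitMeasure b r n) := by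
  constructor
  simp only [orbitMeasure, Measure.smul_apply, Measure.finsetSum_apply, measure_univ,
    Finset.sum_const, Finset.card_range, smul_eq_mul, nsmul_eq_mul, mul_one]
  push_cast
  exact ENNReal.inv_mul_cancel (by simp) (by simp [ENNReal.add_eq_top])

lemma integral_fourier_orbitMeasure (b : ℕ) (r : ℝ) (k : ℤ) (n : ℕ) :
    ∫ y, fourier k y ∂orbitMeasure b r n = weylAverage b r k (n + 1) := by
  rw [orbitMeasure, integral_smul_measure, integral_finsetSum_measure fun j _ => ?_]
  · simp only [integral_dirac, fourier_coe_apply, weylAverage]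
    rw [ENNReal.toReal_inv, ENNReal.toReal_add (ENNReal.natCast_ne_top n) ENNReal.one_ne_top,
      Complex.real_smul]
    push_cast
    rw [ENNReal.toReal_natCast, one_div]
    simp only [Complex.ofReal_natCast, ENNReal.toReal_one, Complex.ofReal_one, div_one, mul_assoc]
  · exact (fourier k).continuous.integrable_of_hasCompactSupport
      (HasCompactSupport.of_compactSpace _)

lemma weylAverage_nat_mul (b : ℕ) (r : ℝ) (m : ℕ) (k : ℤ) (n : ℕ) :
    weylAverage b (m * r) k n = weylAverage b r (k * m) n := by
  simp only [weylAverage]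
  congr 1
  refine Finset.sum_congr rfl fun j _ => ?_
  congr 1
  push_cast
  ring

lemma integral_fourier_map_nsmul (μ : Measure UnitAddCircle) (m : ℕ) (k : ℤ) :
    ∫ y, fourier k y ∂(μ.map fun y : UnitAddCircle => m • y) = ∫ y, fourier (k * m) y ∂μ := by
  have hm : Continuous fun y : UnitAddCircle => m • y := by fun_prop
  rw [integral_map hm.aemeasurable (fourier k).continuous.aestronglyMeasurable]
  simp only [fourier_apply, mul_smul, natCast_zsmul]

lemma exists_subseq_mem_limitMeasures (b : ℕ) (r : ℝ) {n : ℕ → ℕ} (hn : StrictMono n) :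
    ∃ μ : Measure UnitAddCircle, IsProbabilityMeasure μ ∧ ∃ φ : ℕ → ℕ, StrictMono φ ∧
      ∀ k : ℤ, Tendsto (fun s => weylAverage b r k (n (φ s))) atTop
        (𝓝 (∫ y, fourier k y ∂μ)) := by
  let P : ℕ → ProbabilityMeasure UnitAddCircle := fun s =>
    -- `orbitMeasure` at index `N` averages `N + 1` points; shifting `s` by one guarantees `n (s +
    -- 1) ≥ 1`.
    ⟨orbitMeasure b r (n (s + 1) - 1), inferInstance⟩
  obtain ⟨μ, φ, hφ, hlim⟩ := CompactSpace.tendsto_subseq P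
  refine ⟨μ, inferInstance, fun s => φ s + 1, fun s t hst => Nat.succ_lt_succ (hφ hst),
    fun k => ?_⟩
  have h := (ProbabilityMeasure.tendsto_iff_forall_integral_rclike_tendsto ℂ).1 hlim
    (BoundedContinuousFunction.mkOfCompact (fourier k))
  refine h.congr fun s => ?_
  have h1 : n (φ s + 1) - 1 + 1 = n (φ s + 1) :=
    Nat.sub_add_cancel (Nat.one_le_of_lt (hn (Nat.succ_pos (φ s))))
  have h2 := integral_fourier_orbitMeasure b r k (n (φ s + 1) - 1)
  rw [h1] at h2
  exact h2

lemma limitMeasures_nat_mul (b : ℕ) (r : ℝ) (m : ℕ) :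
    limitMeasures b (m * r) =
      (fun μ => μ.map (fun y : UnitAddCircle => m • y)) '' limitMeasures b r := by
  have hmap : ∀ μ : Measure UnitAddCircle, IsProbabilityMeasure μ →
      IsProbabilityMeasure (μ.map fun y : UnitAddCircle => m • y) := fun μ _ =>
    Measure.isProbabilityMeasure_map (by fun_prop : Continuous _).aemeasurable
  ext ν
  constructor
  · rintro ⟨hν, n, hn, hlim⟩
    -- Along `n` only frequencies divisible by `m` are known to converge for `r`, so a further
    -- subsequence is extracted.
    obtain ⟨μ, hμ, φ, hφ, hsub⟩ := exists_subseq_mem_limitMeasures b r hn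
    refine ⟨μ, ⟨hμ, n ∘ φ, hn.comp hφ, hsub⟩, ?_⟩
    have := hmap μ hμ
    refine ext_of_integral_fourier_eq fun k => ?_
    rw [integral_fourier_map_nsmul]
    refine tendsto_nhds_unique (hsub (k * m)) ?_
    simpa only [weylAverage_nat_mul, Function.comp_def] using (hlim k).comp hφ.tendsto_atTop
  · rintro ⟨μ, ⟨hμ, n, hn, hlim⟩, rfl⟩
    refine ⟨hmap μ hμ, n, hn, fun k => ?_⟩
    rw [integral_fourier_map_nsmul]
    simpa only [weylAverage_nat_mul] using hlim (k * m)

end LimitMeasures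

end FiniteState

theorem mainTheorem5 (b : ℕ) [NeZero b] (hb : 2 ≤ b) (r : ℝ) :
    (∀ x : ℕ → Fin b, FiniteState.IsExpansion x r →
      FiniteState.seqDim x = FiniteState.dim b r ∧
      FiniteState.seqStrongDim x = FiniteState.strongDim b r) ∧
    (∀ m : ℕ, 0 < m →
      FiniteState.dim b ((m : ℝ) * r) = FiniteState.dim b r ∧
      FiniteState.strongDim b ((m : ℝ) * r) = FiniteState.strongDim b r) ∧
    (∀ q : ℚ, q ≠ 0 →
      FiniteState.dim b ((q : ℝ) + r) = FiniteState.dim b r ∧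
      FiniteState.dim b ((q : ℝ) * r) = FiniteState.dim b r ∧
      FiniteState.strongDim b ((q : ℝ) + r) = FiniteState.strongDim b r ∧
      FiniteState.strongDim b ((q : ℝ) * r) = FiniteState.strongDim b r) ∧
    (∀ m : ℕ, 0 < m →
      FiniteState.limitMeasures b ((m : ℝ) * r) =
        (fun μ => μ.map (fun y : UnitAddCircle => m • y)) '' FiniteState.limitMeasures b r) := by
  refine ⟨fun x hx => ?_, fun m hm => ?_, fun q hq => ?_, fun m _ =>
    FiniteState.limitMeasures_nat_mul b r m⟩
  · exact FiniteState.dims_eq_of_isExpansion hb (m := 1) (z := 0) one_ne_zero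
      (FiniteState.isExpansion_digits hb r) (by simpa using hx)
  · simpa using FiniteState.dim_int_mul_add hb r (Nat.cast_ne_zero.2 hm.ne') 0
  · have h1 := FiniteState.dim_rat_add hb r q
    have h2 := FiniteState.dim_rat_mul hb r hq
    exact ⟨h1.1, h2.1, h1.2, h2.2⟩
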